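/- Let $K$ be a number field. For a nonzero $\alpha\in K$ and a separable polynomial $P(x)\in K[x]$ of degree $4$, the Châtelet surface over $K$ defined by $y^2-\alpha z^2=P(x)$ is the smooth projective surface obtained by gluing the surface $Y^2-\alpha Z^2=W^2P(x)$ in $(\mathbb{P}^1\setminus\{\infty\})\times\mathbb{P}^2$, with coordinates $(x,(Y:Z:W))$, and the surface $Y^2-\alpha Z^2=W'^2P^*(x')$ in $(\mathbb{P}^1\setminus\{0\})\times\mathbb{P}^2$, with coordinates $(x',(Y:Z:W'))$, via $x=1/x'$ and $W=x'^2W'$, where $P^*(x')=x'^4P(1/x')$. Let $a\in\mathcal{O}_K$ be nonzero and such that $a$ is a square in the completion $K_v$ for every place $v$ of $K$ above $2$ and for every real place $v$ of $K$. Let $v_0$ be a non-archimedean place of $K$ such that the normalised valuation $v_0(a)$ is odd. Then there exist $A,C,E\in K$ with $E\neq 0$ such that $Ax^4+Cx^2+E$ is separable of degree $4$ and the Châtelet surface $\mathcal{S}$ over $K$ defined by $$y^2-az^2=Ax^4+Cx^2+E$$ satisfies $\mathcal{S}(K_{v_0})=\varnothing$ and $\mathcal{S}(K_v)\neq\varnothing$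 for every place $v\neq v_0$ of $K$, archimedean or not. In particular, $\mathcal{S}(L)=\varnothing$ for every finite extension $L$ of $K$ in which $v_0$ splits completely. -/

import Mathlib

open scoped NumberField LinearAlgebra.Projectivization
open IsDedekindDomain Polynomial

/-- A Châtelet surface over a field `K` of characteristic `0`, given by its affine equation
`y² - a z² = P(x)` with `a ≠ 0` and `P` separable of degree `4`; separability of `P` is the
Jacobian criterion for smoothness of the projective model described below. -/
structure ChateletSurface (K : Type*) [Field K] [CharZero K] where
  a : K
  P : K[X]
  a_ne_zero : a ≠ 0
  natDegree_P : P.natDegree = 4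
  separable_P : P.Separable

namespace ChateletSurface

/-- The `F`-points of the plane conic `Y² - α Z² = β W²`, where `(Y : Z : W)` are homogeneous
coordinates on `ℙ²`.  The equation is homogeneous of degree two, so it can be required for all
vectors on the line `p`. -/
def conic {F : Type*} [Field F] (α β : F) : Set (ℙ F (Fin 3 → F)) :=
  {p | ∀ v ∈ p.submodule, v 0 ^ 2 - α * v 1 ^ 2 = β * v 2 ^ 2}

section

variable {K : Type*} [Field K] [CharZero K] (S : ChateletSurface K)
  (F : Type*) [Field F] [Algebra K F]

/-- The `F`-points of the part of the projective model over `ℙ¹ ∖ {∞}`: the surface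
`Y² - a Z² = W² P(x)` in `𝔸¹ × ℙ²`, with coordinates `(x, (Y : Z : W))`. -/
def FinitePart : Type _ :=
  {q : F × ℙ F (Fin 3 → F) // q.2 ∈ conic (algebraMap K F S.a) (aeval q.1 S.P)}

/-- The `F`-points of the part of the projective model over `ℙ¹ ∖ {0}`: the surface
`Y² - a Z² = W'² P*(x')` in `𝔸¹ × ℙ²`, with coordinates `(x', (Y : Z : W'))`, where
`P*(x') = x'⁴ P(1/x')` is the reciprocal polynomial. -/
def InftyPart : Type _ :=
  {q : F × ℙ F (Fin 3 → F) // q.2 ∈ conic (algebraMap K F S.a) (aeval q.1 S.P.reverse)}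

/-- The identification of the two parts over `ℙ¹ ∖ {0, ∞}`: `x = 1 / x'` and `W = x'² W'`. -/
inductive Glue : S.FinitePart F ⊕ S.InftyPart F → S.FinitePart F ⊕ S.InftyPart F → Prop
  | mk (q : S.FinitePart F) (q' : S.InftyPart F) (hx : q.1.1 * q'.1.1 = 1)
      (Y Z W W' : F) (hv : ![Y, Z, W] ≠ 0) (hv' : ![Y, Z, W'] ≠ 0)
      (hq : q.1.2 = Projectivization.mk F ![Y, Z, W] hv)
      (hq' : q'.1.2 = Projectivization.mk F ![Y, Z, W'] hv')
      (hW : W = q'.1.1 ^ 2 * W') : Glue (Sum.inl q) (Sum.inr q')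

/-- The set `S(F)` of `F`-points of the smooth projective model of the affine surface
`y² - a z² = P(x)`, for a field extension `F` of `K`; the model is glued from the parts over
`ℙ¹ ∖ {∞}` and `ℙ¹ ∖ {0}`. -/
def Points : Type _ := Quot (S.Glue F)

end

end ChateletSurface

section

variable {K : Type*} [Field K] [NumberField K]

/-- `a` is a square in the completion `K_v` for all places `v` above `2` and all real places
`v`. -/
def IsTwoRealLocalSquare (a : K) : Prop :=
  (∀ v : HeightOneSpectrum (𝓞 K), (2 : 𝓞 K) ∈ v.asIdeal →
    IsSquare (algebraMap K (v.adicCompletion K) a)) ∧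
  (∀ v : NumberField.InfinitePlace K, v.IsReal → IsSquare (algebraMap K v.Completion a))

/-- The additive normalised valuation `v(x)` of `x ≠ 0` at a finite place `v`
(with the convention `v(0) = 0`). -/
noncomputable def addVal (v : HeightOneSpectrum (𝓞 K)) (x : K) : ℤ :=
  -WithZero.log (v.valuation K x)

/-- The finite place `v` of `K` splits completely in the finite extension `L`: every prime of `L`
above `v` has ramification index and residue degree `1`. -/
def SplitsCompletely (v : HeightOneSpectrum (𝓞 K)) (L : Type*) [Field L] [Algebra K L] : Prop :=
  ∀ Q : Ideal (𝓞 L), Q.IsPrime → Q.LiesOver v.asIdeal →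
    Q.ramificationIdx (𝓞 K) = 1 ∧ Q.inertiaDeg (𝓞 K) = 1

end

/-! The surface is y² - az² = Ax⁴ - aB, with A, B integral and nonsquare modulo v₀. Its equation
regroups as Y² - A(x²W)² = a(Z² - BW²). Both binary forms take only even valuations on nonzero
vectors (`Valuation.map_sq_sub_mul_sq`) and v₀(a) is odd, so only the zero vector solves it. This
argument needs only a valuation, hence also applies to L, where complete splitting keeps the
valuation and the residue field.

Elsewhere, if a is a local square, every fibre has a point. At other v ≠ v₀, `exists_coefficients`
gives A ≡ 1 mod v when v divides a, and A, B never both divisible by v. So A is a square, or one of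
A, -aB is a unit represented by y² - az² with a a unit; this yields a point over x = ∞ or x = 0. -/

/-! ### Square roots by Newton iteration -/

section Hensel

variable {F : Type*} [NormedField F] [IsUltrametricDist F]

theorem norm_eq_one_of_norm_sq_sub_lt_one {u y : F} (hu : ‖u‖ = 1) (h : ‖y ^ 2 - u‖ < 1) :
    ‖y‖ = 1 := by
  have h1 : ‖(y ^ 2 - u) + u‖ = max ‖y ^ 2 - u‖ ‖u‖ :=
    IsUltrametricDist.norm_add_eq_max_of_norm_ne_norm (by rw [hu]; exact h.ne)
  rw [sub_add_cancel, hu, max_eq_right h.le, norm_pow] at h1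
  exact (pow_eq_one_iff_of_nonneg (norm_nonneg _) two_ne_zero).1 h1

/-- Hensel's lemma for square roots: one step of Newton's iteration squares the error. -/
theorem isSquare_of_norm_sq_sub_lt_one [CompleteSpace F] (h2 : ‖(2 : F)‖ = 1) {u y : F}
    (hu : ‖u‖ = 1) (h : ‖y ^ 2 - u‖ < 1) : IsSquare u := by
  set d := ‖y ^ 2 - u‖ with hd
  let step : F → F := fun t => t - (t ^ 2 - u) / (2 * t)
  let f : ℕ → F := fun n => step^[n] y
  have f_succ (n : ℕ) : f (n + 1) = step (f n) := Function.iterate_succ_apply' step n y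
  have hpow (n : ℕ) : d ^ (n + 1) < 1 := pow_lt_one₀ (norm_nonneg _) h n.succ_ne_zero
  -- The error is really d^(2^n); this weaker geometric bound already gives a Cauchy sequence.
  have inv (n : ℕ) : ‖f n ^ 2 - u‖ ≤ d ^ (n + 1) := by
    induction n with
    | zero => simp [f, d]
    | succ n ih =>
      have hn : ‖f n‖ = 1 := norm_eq_one_of_norm_sq_sub_lt_one hu (ih.trans_lt (hpow n))
      have h0 : f n ≠ 0 := norm_ne_zero_iff.1 (by rw [hn]; exact one_ne_zero)
      have h20 : (2 : F) ≠ 0 := norm_ne_zero_iff.1 (by rw [h2]; exact one_ne_zero)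
      have key : f (n + 1) ^ 2 - u = ((f n ^ 2 - u) / (2 * f n)) ^ 2 := by
        rw [f_succ]
        simp only [step]
        field_simp
        ring
      rw [key, norm_pow, norm_div, norm_mul, h2, hn, mul_one, div_one]
      calc ‖f n ^ 2 - u‖ ^ 2 ≤ (d ^ (n + 1)) ^ 2 := by gcongr
        _ = d ^ (n + 1 + 1) * d ^ n := by ring
        _ ≤ d ^ (n + 1 + 1) :=
          mul_le_of_le_one_right (by positivity) (pow_le_one₀ (norm_nonneg _) h.le)
  have hn (n : ℕ) : ‖f n‖ = 1 :=
    norm_eq_one_of_norm_sq_sub_lt_one hu ((inv n).trans_lt (hpow n))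
  have cau : CauchySeq f := by
    refine cauchySeq_of_le_geometric d 1 h fun n => ?_
    rw [f_succ, dist_eq_norm, show f n - step (f n) = (f n ^ 2 - u) / (2 * f n) by simp [step],
      norm_div, norm_mul, h2, hn, mul_one, div_one, one_mul]
    exact (inv n).trans (pow_le_pow_of_le_one (norm_nonneg _) h.le n.le_succ)
  obtain ⟨x, hx⟩ := cauchySeq_tendsto_of_complete cau
  have l1 : Filter.Tendsto (fun n => f n ^ 2 - u) Filter.atTop (nhds (x ^ 2 - u)) :=
    (hx.pow 2).sub_const u
  have l2 : Filter.Tendsto (fun n => f n ^ 2 - u) Filter.atTop (nhds 0) := by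
    refine squeeze_zero_norm inv ?_
    exact (tendsto_pow_atTop_nhds_zero_of_lt_one (norm_nonneg _) h).comp
      (Filter.tendsto_add_atTop_nat 1)
  exact ⟨x, by rw [← sq, eq_comm]; exact sub_eq_zero.1 (tendsto_nhds_unique l1 l2)⟩

end Hensel

/-! ### Anisotropy by parity of valuations -/

section Anisotropic

open WithZero

variable {F : Type*} [Field F] {v : Valuation F ℤᵐ⁰}

/-- If Y dominates, so does Y². Otherwise divide by S: Y/S is integral, and `hA'` says that A is not
a square modulo the maximal ideal, so (Y/S)² - A is a unit. -/
theorem Valuation.map_sq_sub_mul_sq {A : F} (hA : v A ≤ 1)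
    (hA' : ∀ y, v y ≤ 1 → 1 ≤ v (y ^ 2 - A)) (Y S : F) :
    v (Y ^ 2 - A * S ^ 2) = max (v Y) (v S) ^ 2 := by
  rcases lt_or_ge (v S) (v Y) with h | h
  · rw [max_eq_left h.le, ← map_pow]
    refine Valuation.map_sub_eq_of_lt_left v ?_
    rw [map_mul, map_pow, map_pow]
    exact (mul_le_of_le_one_left' hA).trans_lt (pow_lt_pow_left₀ h zero_le two_ne_zero)
  · rw [max_eq_right h]
    rcases eq_or_ne S 0 with rfl | hS
    · obtain rfl : Y = 0 := by simpa using h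
      simp
    have hy : v (Y / S) ≤ 1 := by
      rw [map_div₀]
      exact div_le_one_of_le₀ h zero_le
    have h1 : v ((Y / S) ^ 2 - A) = 1 := by
      refine le_antisymm ((v.map_sub _ _).trans (max_le ?_ hA)) (hA' _ hy)
      rw [map_pow]
      exact pow_le_one₀ zero_le hy
    rw [show Y ^ 2 - A * S ^ 2 = ((Y / S) ^ 2 - A) * S ^ 2 by field_simp, map_mul, h1, one_mul,
      map_pow]

theorem Valuation.eq_zero_of_sq_sub_mul_sq_eq {a A B : F} (ha : Odd (log (v a)))
    (hA : v A ≤ 1) (hA' : ∀ y, v y ≤ 1 → 1 ≤ v (y ^ 2 - A))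
    (hB : v B ≤ 1) (hB' : ∀ y, v y ≤ 1 → 1 ≤ v (y ^ 2 - B)) {Y S Z T : F}
    (h : Y ^ 2 - A * S ^ 2 = a * (Z ^ 2 - B * T ^ 2)) : Y = 0 ∧ S = 0 ∧ Z = 0 ∧ T = 0 := by
  have ha0 : v a ≠ 0 := fun h => by simp [h] at ha
  have h1 : max (v Y) (v S) ^ 2 = v a * max (v Z) (v T) ^ 2 := by
    rw [← map_sq_sub_mul_sq hA hA', ← map_sq_sub_mul_sq hB hB', h, map_mul]
  have h2 : max (v Z) (v T) = 0 := by
    by_contra hm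
    have hm' : max (v Y) (v S) ≠ 0 := fun h0 => by
      rw [h0, zero_pow two_ne_zero, eq_comm] at h1
      exact mul_ne_zero ha0 (pow_ne_zero 2 hm) h1
    -- Logarithms equate an even integer with an odd one.
    have h3 := congrArg log h1
    rw [log_pow, log_mul ha0 (pow_ne_zero 2 hm), log_pow] at h3
    obtain ⟨k, hk⟩ := ha
    simp only [nsmul_eq_mul, Nat.cast_ofNat] at h3
    lia
  have h3 : max (v Y) (v S) = 0 := by simpa [h2] using h1
  have key {x y : F} (h : max (v x) (v y) = 0) : x = 0 ∧ y = 0 := by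
    constructor <;> rw [← v.zero_iff, ← le_zero_iff, ← h]
    exacts [le_max_left _ _, le_max_right _ _]
  exact ⟨(key h3).1, (key h3).2, key h2⟩

end Anisotropic

/-! ### Points on conic fibres and the biquadratic surface -/

namespace ChateletSurface

open scoped WithZero

section Conic

variable {F : Type*} [Field F]

theorem mk_mem_conic {α β : F} {w : Fin 3 → F} (hw : w ≠ 0) :
    Projectivization.mk F w hw ∈ conic α β ↔ w 0 ^ 2 - α * w 1 ^ 2 = β * w 2 ^ 2 := by
  simp only [conic, Set.mem_ofPred_eq, Projectivization.submodule_mk]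
  refine ⟨fun h => h w (Submodule.mem_span_singleton_self w), fun h x hx => ?_⟩
  obtain ⟨c, rfl⟩ := Submodule.mem_span_singleton.1 hx
  simp only [Pi.smul_apply, smul_eq_mul]
  linear_combination c ^ 2 * h

theorem conic_eq_empty {α β : F}
    (h : ∀ Y Z W : F, Y ^ 2 - α * Z ^ 2 = β * W ^ 2 → Y = 0 ∧ Z = 0 ∧ W = 0) :
    conic α β = ∅ := by
  refine Set.eq_empty_of_forall_notMem fun p hp => ?_
  induction p with
  | h w hw =>
    obtain ⟨h0, h1, h2⟩ := h _ _ _ ((mk_mem_conic hw).1 hp)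
    refine hw (funext fun i => ?_)
    fin_cases i <;> assumption

end Conic

variable {K : Type*} [Field K] [CharZero K] (S : ChateletSurface K)
  (F : Type*) [Field F] [Algebra K F]

variable {F} in
theorem nonempty_points_of_isSquare (h : IsSquare (algebraMap K F S.a)) :
    Nonempty (S.Points F) := by
  obtain ⟨s, hs⟩ := h
  have hw : ![s, 1, 0] ≠ 0 := fun h => one_ne_zero (congrFun h 1)
  exact ⟨Quot.mk _ (.inl ⟨(0, Projectivization.mk F _ hw),
    (mk_mem_conic hw).2 (by simp [hs, sq])⟩)⟩

variable {F} in
theorem nonempty_points_of_eq_eval_zero {Y Z : F}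
    (h : Y ^ 2 - algebraMap K F S.a * Z ^ 2 = algebraMap K F (S.P.coeff 0)) :
    Nonempty (S.Points F) := by
  have hw : ![Y, Z, 1] ≠ 0 := fun h => one_ne_zero (congrFun h 2)
  refine ⟨Quot.mk _ (.inl ⟨(0, Projectivization.mk F _ hw), (mk_mem_conic hw).2 ?_⟩)⟩
  simpa [← coeff_zero_eq_aeval_zero'] using h

variable {F} in
theorem nonempty_points_of_eq_leadingCoeff {Y Z : F}
    (h : Y ^ 2 - algebraMap K F S.a * Z ^ 2 = algebraMap K F S.P.leadingCoeff) :
    Nonempty (S.Points F) := by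
  have hw : ![Y, Z, 1] ≠ 0 := fun h => one_ne_zero (congrFun h 2)
  refine ⟨Quot.mk _ (.inr ⟨(0, Projectivization.mk F _ hw), (mk_mem_conic hw).2 ?_⟩)⟩
  simpa [← coeff_zero_eq_aeval_zero', coeff_zero_reverse] using h

theorem isEmpty_points
    (h : ∀ x, conic (algebraMap K F S.a) (aeval x S.P) = ∅)
    (h' : ∀ x, conic (algebraMap K F S.a) (aeval x S.P.reverse) = ∅) :
    IsEmpty (S.Points F) := by
  refine ⟨fun p => ?_⟩
  induction p using Quot.ind with
  | mk q =>
    rcases q with ⟨q, hq⟩ | ⟨q, hq⟩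
    · rwa [h] at hq
    · rwa [h'] at hq

/-- The Châtelet surface `y² - a z² = A x⁴ - a B`. -/
noncomputable def biquadratic {a A B : K} (ha : a ≠ 0) (hA : A ≠ 0) (hB : B ≠ 0) :
    ChateletSurface K where
  a := a
  -- The zero quadratic term keeps the shape required in the main theorem, where the equation for P
  -- is then `rfl`.
  P := C A * X ^ 4 + C 0 * X ^ 2 + C (-(a * B))
  a_ne_zero := ha
  natDegree_P := by compute_degree!
  separable_P := by
    have h4 : (4 : K) ≠ 0 := by norm_num
    -- Bézout coefficients from xP' - 4P = 4aB.
    refine ⟨C (-(a * B)⁻¹), C ((a * B)⁻¹ * 4⁻¹) * X, ?_⟩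
    simp only [derivative_add, derivative_mul, derivative_C, derivative_X_pow, zero_mul, zero_add,
      map_zero, add_zero]
    have e1 : (C (-(a * B)⁻¹) * C (-(a * B)) : K[X]) = 1 := by
      rw [← C_mul, neg_mul_neg, inv_mul_cancel₀ (mul_ne_zero ha hB), C_1]
    have e2 : (C ((a * B)⁻¹ * 4⁻¹) * C ((4 : ℕ) : K) : K[X]) = - C (-(a * B)⁻¹) := by
      rw [← C_mul, ← C_neg, Nat.cast_ofNat, mul_assoc, inv_mul_cancel₀ h4, mul_one, neg_neg]
    linear_combination e1 + C A * X ^ 4 * e2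

variable {a A B : K} (ha : a ≠ 0) (hA : A ≠ 0) (hB : B ≠ 0)

theorem reverse_biquadratic_P :
    (biquadratic ha hA hB).P.reverse = C (-(a * B)) * X ^ 4 + C A := by
  have hd : (C A * X ^ 4 + C 0 * X ^ 2 + C (-(a * B))).natDegree = 4 :=
    (biquadratic ha hA hB).natDegree_P
  simp only [biquadratic]
  rw [reverse, hd]
  rw [reflect_add, reflect_add, reflect_C_mul_X_pow, reflect_C_mul_X_pow, reflect_C,
    revAt_le le_rfl]
  simp only [map_zero, zero_mul, add_zero, tsub_self, pow_zero, mul_one]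
  ring

theorem leadingCoeff_biquadratic_P : (biquadratic ha hA hB).P.leadingCoeff = A := by
  rw [leadingCoeff, natDegree_P]
  simp [biquadratic]

theorem coeff_zero_biquadratic_P : (biquadratic ha hA hB).P.coeff 0 = -(a * B) := by
  simp [biquadratic]

theorem isEmpty_points_biquadratic (v : Valuation F ℤᵐ⁰)
    (hv : Odd (WithZero.log (v (algebraMap K F a))))
    (hvA : v (algebraMap K F A) ≤ 1)
    (hvA' : ∀ y, v y ≤ 1 → 1 ≤ v (y ^ 2 - algebraMap K F A))
    (hvB : v (algebraMap K F B) ≤ 1)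
    (hvB' : ∀ y, v y ≤ 1 → 1 ≤ v (y ^ 2 - algebraMap K F B)) :
    IsEmpty ((biquadratic ha hA hB).Points F) := by
  refine isEmpty_points _ F (fun x => conic_eq_empty fun Y Z W h => ?_)
    fun x => conic_eq_empty fun Y Z W h => ?_
  · obtain ⟨h1, -, h3, h4⟩ := Valuation.eq_zero_of_sq_sub_mul_sq_eq hv hvA hvA' hvB hvB'
      (Y := Y) (S := x ^ 2 * W) (Z := Z) (T := W) (by
        simp [biquadratic] at h
        linear_combination h)
    exact ⟨h1, h3, h4⟩
  · obtain ⟨h1, h2, h3, -⟩ := Valuation.eq_zero_of_sq_sub_mul_sq_eq hv hvA hvA' hvB hvB'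
      (Y := Y) (S := W) (Z := Z) (T := x ^ 2 * W) (by
        simp [reverse_biquadratic_P] at h
        simp [biquadratic] at h
        linear_combination h)
    exact ⟨h1, h3, h2⟩

end ChateletSurface

/-! ### Finite fields and congruences -/

theorem FiniteField.exists_sq_sub_mul_sq_eq {k : Type*} [Field k] [Finite k] (h2 : (2 : k) ≠ 0)
    {a : k} (ha : a ≠ 0) (c : k) : ∃ y z : k, y ^ 2 - a * z ^ 2 = c := by
  have := Fintype.ofFinite k
  have hk : ringChar k ≠ 2 := fun h => h2 (by
    have := ringChar.Nat.cast_ringChar (R := k)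
    rwa [h, Nat.cast_ofNat] at this)
  obtain ⟨y, z, h⟩ := FiniteField.exists_root_sum_quadratic (R := k) (f := X ^ 2)
    (g := C (-a) * X ^ 2 + C 0 * X + C (-c)) (degree_X_pow 2) (degree_quadratic (neg_ne_zero.2 ha))
    (FiniteField.odd_card_of_char_ne_two hk)
  refine ⟨y, z, ?_⟩
  simp at h
  linear_combination h

theorem Ideal.exists_sub_one_mem_and_sub_mem {R : Type*} [CommRing R] {m J : Ideal R}
    [hm : m.IsMaximal] (h : ¬ J ≤ m) (u : R) : ∃ c, c - 1 ∈ J ∧ c - u ∈ m := by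
  have htop : m ⊔ J = ⊤ := hm.1.2 _ (left_lt_sup.2 h)
  obtain ⟨e, he, f, hf, hef⟩ := Submodule.mem_sup.1 (htop ▸ Submodule.mem_top : (1 : R) ∈ m ⊔ J)
  refine ⟨1 + (u - 1) * f, ?_, ?_⟩
  · rw [add_sub_cancel_left]
    exact J.mul_mem_left _ hf
  · rw [show 1 + (u - 1) * f - u = (1 - u) * e by linear_combination (u - 1) * hef]
    exact m.mul_mem_left _ he

theorem IsDedekindDomain.HeightOneSpectrum.exists_span_eq_pow_mul {R : Type*} [CommRing R]
    [IsDedekindDomain R] (v : HeightOneSpectrum R) {a : R} (ha : a ≠ 0) :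
    ∃ (n : ℕ) (J : Ideal R), Ideal.span {a} = v.asIdeal ^ n * J ∧ ¬ J ≤ v.asIdeal := by
  have h0 : Ideal.span {a} ≠ 0 := by simpa [Ideal.zero_eq_bot] using ha
  obtain ⟨J, hJ, hv⟩ :=
    (FiniteMultiplicity.of_prime_left v.prime h0).exists_eq_pow_mul_and_not_dvd
  exact ⟨_, J, hJ, fun h => hv (Ideal.dvd_iff_le.2 h)⟩

/-! ### Local solubility at odd places -/

section LocalSolubility

variable {K : Type*} [Field K] [NumberField K] (v : HeightOneSpectrum (𝓞 K))

instance : Finite (𝓞 K ⧸ v.asIdeal) := v.asIdeal.finiteQuotientOfFreeOfNeBot v.ne_bot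

theorem isUltrametricDist_adicCompletion : IsUltrametricDist (v.adicCompletion K) := by
  refine IsUltrametricDist.isUltrametricDist_of_forall_norm_add_le_max_norm fun x y => ?_
  simp only [NumberField.FinitePlace.norm_def]
  have hm := (WithZeroMulInt.toNNReal_strictMono
    (NumberField.HeightOneSpectrum.one_lt_absNorm_nnreal v)).monotone
  exact_mod_cast (hm (Valuation.map_add _ x y)).trans_eq (hm.map_max)

variable {v}

theorem isSquare_adicCompletion_of_sq_sub_mem (h2 : (2 : 𝓞 K) ∉ v.asIdeal) {c y : 𝓞 K}
    (hc : c ∉ v.asIdeal) (h : y ^ 2 - c ∈ v.asIdeal) :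
    IsSquare (algebraMap K (v.adicCompletion K) c) := by
  have := isUltrametricDist_adicCompletion v
  have e (x : 𝓞 K) : NumberField.FinitePlace.embedding v (algebraMap (𝓞 K) K x) =
    algebraMap K (v.adicCompletion K) x := rfl
  refine isSquare_of_norm_sq_sub_lt_one (y := algebraMap K (v.adicCompletion K) y) ?_ ?_ ?_
  · have := (NumberField.FinitePlace.norm_eq_one_iff_notMem K v 2).2 h2
    rw [e] at this
    simpa only [map_ofNat] using this
  · rw [← e, NumberField.FinitePlace.norm_eq_one_iff_notMem]
    exact hc
  · have := (NumberField.FinitePlace.norm_lt_one_iff_mem K v _).2 h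
    rw [e] at this
    simpa using this

theorem exists_sq_sub_mul_sq_eq_adicCompletion (h2 : (2 : 𝓞 K) ∉ v.asIdeal) {a c : 𝓞 K}
    (ha : a ∉ v.asIdeal) (hc : c ∉ v.asIdeal) :
    ∃ Y Z : v.adicCompletion K, Y ^ 2 - algebraMap K _ (a : K) * Z ^ 2 = algebraMap K _ (c : K) := by
  let := Ideal.Quotient.field v.asIdeal
  have hq {x : 𝓞 K} : Ideal.Quotient.mk v.asIdeal x ≠ 0 ↔ x ∉ v.asIdeal :=
    Ideal.Quotient.eq_zero_iff_mem.not
  obtain ⟨y, z, hyz⟩ := FiniteField.exists_sq_sub_mul_sq_eq (k := 𝓞 K ⧸ v.asIdeal)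
    (by simpa only [map_ofNat] using hq.2 h2) (hq.2 ha) (Ideal.Quotient.mk _ c)
  obtain ⟨y, rfl⟩ := Ideal.Quotient.mk_surjective y
  obtain ⟨z, rfl⟩ := Ideal.Quotient.mk_surjective z
  have hmem : y ^ 2 - (c + a * z ^ 2) ∈ v.asIdeal := by
    rw [← Ideal.Quotient.eq_zero_iff_mem]
    simp only [map_sub, map_add, map_mul, map_pow]
    linear_combination hyz
  -- Hensel lifts y only if c + az² is a unit. Otherwise -ca ≡ (az)² is a unit square s², and (0,
  -- s/a) is a solution.
  by_cases hcz : c + a * z ^ 2 ∈ v.asIdeal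
  · have h1 : (a * z) ^ 2 - (-(c * a)) ∈ v.asIdeal := by
      rw [show (a * z) ^ 2 - (-(c * a)) = a * (c + a * z ^ 2) by ring]
      exact v.asIdeal.mul_mem_left _ hcz
    obtain ⟨s, hs⟩ := isSquare_adicCompletion_of_sq_sub_mem h2
      (fun h => (v.isPrime.mem_or_mem (neg_mem_iff.1 h)).elim hc ha) h1
    have ha0 : algebraMap K (v.adicCompletion K) (a : K) ≠ 0 := by
      rw [ne_eq, FaithfulSMul.algebraMap_eq_zero_iff, NumberField.RingOfIntegers.coe_eq_zero_iff]
      rintro rfl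
      exact ha (zero_mem _)
    refine ⟨0, s / algebraMap K _ (a : K), ?_⟩
    simp only [map_neg, map_mul] at hs
    field_simp
    linear_combination hs
  · obtain ⟨s, hs⟩ := isSquare_adicCompletion_of_sq_sub_mem h2 hcz hmem
    refine ⟨s, algebraMap K _ (z : K), ?_⟩
    simp only [map_add, map_mul, map_pow] at hs
    linear_combination -hs

variable (v) in
theorem valued_algebraMap_adicCompletion (k : K) :
    Valued.v (algebraMap K (v.adicCompletion K) k) = v.valuation K k :=
  v.valuedAdicCompletion_eq_valuation' k

theorem exists_valued_sub_lt_one {x : v.adicCompletion K} (hx : Valued.v x ≤ 1) :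
    ∃ r : 𝓞 K, Valued.v (x - algebraMap K _ (r : K)) < 1 := by
  have hopen : IsOpen {y : v.adicCompletion K | Valued.v (x - y) < 1} := by
    have : IsOpen {y : v.adicCompletion K | Valued.v y < 1} := by
      simpa using Valued.isOpen_ball (v.adicCompletion K) 1
    exact this.preimage (continuous_const.sub continuous_id)
  obtain ⟨k, hk⟩ := (HeightOneSpectrum.denseRange_algebraMap K v).exists_mem_open hopen
    ⟨x, by simp⟩
  have hk1 : v.valuation K k ≤ 1 := by
    rw [← valued_algebraMap_adicCompletion]
    have h := Valuation.map_sub_le Valued.v hx (le_of_lt (Set.mem_ofPred_eq ▸ hk))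
    rwa [sub_sub_cancel] at h
  obtain ⟨r, hr⟩ := v.exists_valuation_sub_lt_of_integer hk1 1
  refine ⟨r, ?_⟩
  rw [Valuation.map_sub_swap, ← valued_algebraMap_adicCompletion, map_sub] at hr
  have h := Valuation.map_add_lt Valued.v hk hr
  rwa [sub_add_sub_cancel] at h

end LocalSolubility

/-- An integral y is congruent to some element of R, so a square root of A modulo the maximal ideal
could be taken in R. The general `f` serves both the completion at v₀ and L. -/
theorem Valuation.one_le_map_sq_sub {R F Γ : Type*} [CommRing R] [Field F]
    [LinearOrderedCommGroupWithZero Γ] (w : Valuation F Γ) (f : R →+* F)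
    (hres : ∀ y, w y ≤ 1 → ∃ r, w (y - f r) < 1) {A : R}
    (hA : ∀ r, 1 ≤ w (f (r ^ 2 - A))) (y : F) (hy : w y ≤ 1) : 1 ≤ w (y ^ 2 - f A) := by
  by_contra! h
  obtain ⟨r, hr⟩ := hres y hy
  have hr1 : w (f r) ≤ 1 := by
    have := w.map_sub_le hy hr.le
    rwa [sub_sub_cancel] at this
  have h1 : w ((y - f r) * (y + f r)) < 1 := by
    rw [map_mul]
    exact mul_lt_one_of_lt_of_le hr (w.map_add_le hy hr1)
  refine (hA r).not_gt ?_
  rw [show f (r ^ 2 - A) = (y ^ 2 - f A) - (y - f r) * (y + f r) by simp; ring]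
  exact w.map_sub_lt h h1

/-! ### Extensions in which v₀ splits completely -/

section Extension

variable {K : Type*} [Field K] [NumberField K] {v : HeightOneSpectrum (𝓞 K)}

/-- Any prime above v works: ramification index 1 preserves the valuation, and residue degree 1 lets
𝓞 K represent every residue class. -/
theorem SplitsCompletely.exists_heightOneSpectrum {L : Type*} [Field L] [NumberField L]
    [Algebra K L] (h : SplitsCompletely v L) :
    ∃ w : HeightOneSpectrum (𝓞 L),
      (∀ x : K, w.valuation L (algebraMap K L x) = v.valuation K x) ∧
      ∀ y : L, w.valuation L y ≤ 1 →
        ∃ r : 𝓞 K, w.valuation L (y - algebraMap K L (r : K)) < 1 := by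
  obtain ⟨Q, hQ, hQv⟩ := Ideal.exists_maximal_ideal_liesOver_of_isIntegral (S := 𝓞 L) v.asIdeal
  obtain ⟨he, hf⟩ := h Q hQ.isPrime hQv
  have hQ0 : Q ≠ ⊥ := Ideal.ne_bot_of_liesOver_of_ne_bot v.ne_bot Q
  let w : HeightOneSpectrum (𝓞 L) := ⟨Q, hQ.isPrime, hQ0⟩
  have : w.asIdeal.LiesOver v.asIdeal := hQv
  refine ⟨w, fun x => ?_, fun y hy => ?_⟩
  · rw [← HeightOneSpectrum.valuation_liesOver L v w,
      show v.asIdeal.ramificationIdx' w.asIdeal = 1 from ?_, pow_one]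
    rw [← he]
    exact Ideal.ramificationIdx'_eq_ramificationIdx _ _ v.ne_bot
  · obtain ⟨s, hs⟩ := w.exists_valuation_sub_lt_of_integer hy 1
    rw [Ideal.inertiaDeg_eq_of_isMaximal v.asIdeal Q] at hf
    let := Ideal.Quotient.field v.asIdeal
    obtain ⟨c, hc⟩ := (finrank_eq_one_iff_of_nonzero' (1 : 𝓞 L ⧸ Q) one_ne_zero).1 hf
      (Ideal.Quotient.mk Q s)
    obtain ⟨r, rfl⟩ := Ideal.Quotient.mk_surjective c
    have hmem : s - algebraMap (𝓞 K) (𝓞 L) r ∈ w.asIdeal := by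
      rw [← Ideal.Quotient.eq_zero_iff_mem, map_sub, sub_eq_zero, ← hc, Algebra.smul_def, mul_one]
      rfl
    refine ⟨r, ?_⟩
    have hsr : w.valuation L (algebraMap (𝓞 L) L s - algebraMap K L (r : K)) < 1 := by
      have h1 : w.valuation L (algebraMap (𝓞 L) L (s - algebraMap (𝓞 K) (𝓞 L) r)) < 1 :=
        (w.valuation_lt_one_iff_mem _).2 hmem
      rwa [map_sub (algebraMap (𝓞 L) L)] at h1
    rw [Valuation.map_sub_swap] at hs
    have := Valuation.map_add_lt _ hs hsr
    rwa [sub_add_sub_cancel] at this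

end Extension

theorem isSquare_completion_of_isComplex {K : Type*} [Field K]
    {v : NumberField.InfinitePlace K} (hv : v.IsComplex) (x : v.Completion) : IsSquare x := by
  let e := NumberField.InfinitePlace.Completion.ringEquivComplexOfIsComplex hv
  obtain ⟨s, hs⟩ := IsAlgClosed.exists_pow_nat_eq (e x) two_pos
  exact ⟨e.symm s, e.injective (by simp [← hs, sq])⟩

/-! ### Choice of the coefficients -/

section Approximation

variable {K : Type*} [Field K] [NumberField K]

theorem two_notMem_of_odd_addVal {a : 𝓞 K} (hsq : IsTwoRealLocalSquare (a : K))
    {v : HeightOneSpectrum (𝓞 K)} (hv : Odd (addVal v (a : K))) : (2 : 𝓞 K) ∉ v.asIdeal := by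
  intro h
  obtain ⟨s, hs⟩ := hsq.1 v h
  rw [addVal, ← valued_algebraMap_adicCompletion, hs, ← sq, map_pow, WithZero.log_pow,
    odd_neg, nsmul_eq_mul] at hv
  exact Int.not_odd_iff_even.2 (even_two_mul _) hv

theorem exists_sq_sub_notMem {v : HeightOneSpectrum (𝓞 K)} (h2 : (2 : 𝓞 K) ∉ v.asIdeal) :
    ∃ u : 𝓞 K, ∀ c, c - u ∈ v.asIdeal → ∀ r, r ^ 2 - c ∉ v.asIdeal := by
  let := Ideal.Quotient.field v.asIdeal
  obtain ⟨u, hu⟩ := FiniteField.exists_nonsquare (F := 𝓞 K ⧸ v.asIdeal) fun h => h2 (by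
    have := ringChar.Nat.cast_ringChar (R := 𝓞 K ⧸ v.asIdeal)
    rw [h] at this
    rw [← Ideal.Quotient.eq_zero_iff_mem, ← this]
    exact map_ofNat _ 2)
  obtain ⟨u, rfl⟩ := Ideal.Quotient.mk_surjective u
  refine ⟨u, fun c hc r hr => hu ⟨Ideal.Quotient.mk _ r, ?_⟩⟩
  rw [← map_mul, eq_comm, Ideal.Quotient.eq]
  have := add_mem hr hc
  rwa [sub_add_sub_cancel, sq] at this

/-- The coefficients `A`, `B` of a surface `y² - a z² = A x⁴ - a B` that has local points
everywhere except at `v₀`. -/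
theorem exists_coefficients {a : 𝓞 K} (ha : a ≠ 0) {v₀ : HeightOneSpectrum (𝓞 K)}
    (h2 : (2 : 𝓞 K) ∉ v₀.asIdeal) :
    ∃ A B : 𝓞 K, (∀ r, r ^ 2 - A ∉ v₀.asIdeal) ∧ (∀ r, r ^ 2 - B ∉ v₀.asIdeal) ∧
      ∀ v ≠ v₀, (a ∈ v.asIdeal → A - 1 ∈ v.asIdeal) ∧ (A ∈ v.asIdeal → B ∉ v.asIdeal) := by
  obtain ⟨u, hu⟩ := exists_sq_sub_notMem h2
  obtain ⟨n, J, hJ, hJv⟩ := v₀.exists_span_eq_pow_mul ha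
  have := v₀.isMaximal
  -- J is the part of (a) prime to v₀, so A ≡ 1 at every other prime dividing a.
  obtain ⟨A, hA1, hAu⟩ := Ideal.exists_sub_one_mem_and_sub_mem hJv u
  have hA0 : A ∉ v₀.asIdeal := fun h => hu A hAu 0 (by simpa using h)
  -- B ≡ 1 mod A makes A and B coprime; this is compatible with B ≡ u because v₀ does not divide A.
  obtain ⟨B, hB1, hBu⟩ := Ideal.exists_sub_one_mem_and_sub_mem (m := v₀.asIdeal)
    (J := Ideal.span {A}) (by rwa [Ideal.span_singleton_le_iff_mem]) u
  refine ⟨A, B, hu A hAu, hu B hBu, fun v hv => ⟨fun hav => ?_, fun hAv hBv => ?_⟩⟩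
  · have hle : v₀.asIdeal ^ n * J ≤ v.asIdeal := by
      rwa [← hJ, Ideal.span_singleton_le_iff_mem]
    rcases v.isPrime.mul_le.1 hle with h | h
    · exact absurd (HeightOneSpectrum.ext
        (v₀.isMaximal.eq_of_le v.isPrime.ne_top (v.isPrime.le_of_pow_le h)).symm) hv
    · exact h hA1
  · have hB1v : B - 1 ∈ v.asIdeal := (Ideal.span_singleton_le_iff_mem _).2 hAv hB1
    refine v.isPrime.ne_top ((Ideal.eq_top_iff_one _).2 ?_)
    have := sub_mem hBv hB1v
    rwa [sub_sub_cancel] at this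

end Approximation

/-! ### The main theorem -/

theorem proposition2p7 {K : Type*} [Field K] [NumberField K] (a : 𝓞 K) (ha : a ≠ 0)
    (hsq : IsTwoRealLocalSquare (a : K))
    (v₀ : HeightOneSpectrum (𝓞 K)) (hv₀ : Odd (addVal v₀ (a : K))) :
    ∃ (S : ChateletSurface K) (A C E : K),
      S.a = (a : K) ∧
      S.P = Polynomial.C A * X ^ 4 + Polynomial.C C * X ^ 2 + Polynomial.C E ∧
      E ≠ 0 ∧
      IsEmpty (S.Points (v₀.adicCompletion K)) ∧
      (∀ v : HeightOneSpectrum (𝓞 K), v ≠ v₀ → Nonempty (S.Points (v.adicCompletion K))) ∧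
      (∀ v : NumberField.InfinitePlace K, Nonempty (S.Points v.Completion)) ∧
      (∀ (L : Type*) [Field L] [Algebra K L] [FiniteDimensional K L],
        SplitsCompletely v₀ L → IsEmpty (S.Points L)) := by
  have h2 := two_notMem_of_odd_addVal hsq hv₀
  obtain ⟨A, B, hA, hB, hAB⟩ := exists_coefficients ha h2
  have ne_zero {c : 𝓞 K} (hc : ∀ r, r ^ 2 - c ∉ v₀.asIdeal) : (c : K) ≠ 0 := by
    rw [NumberField.RingOfIntegers.coe_ne_zero_iff]
    rintro rfl
    exact hc 0 (by simp)
  have ha' : (a : K) ≠ 0 := by rwa [NumberField.RingOfIntegers.coe_ne_zero_iff]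
  have hlog : Odd (WithZero.log (v₀.valuation K (a : K))) := odd_neg.1 hv₀
  have one_le {c : 𝓞 K} (hc : ∀ r, r ^ 2 - c ∉ v₀.asIdeal) (r : 𝓞 K) :
      1 ≤ v₀.valuation K ((r ^ 2 - c : 𝓞 K) : K) :=
    (v₀.valuation_eq_one_iff_notMem.2 (hc r)).ge
  refine ⟨.biquadratic ha' (ne_zero hA) (ne_zero hB), A, 0, -(a * B), rfl, rfl,
    neg_ne_zero.2 (mul_ne_zero ha' (ne_zero hB)), ?_, fun v hv => ?_, fun v => ?_, ?_⟩
  · have hres {c : 𝓞 K} (hc : ∀ r, r ^ 2 - c ∉ v₀.asIdeal) :=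
      Valuation.one_le_map_sq_sub (R := 𝓞 K) (Valued.v (R := v₀.adicCompletion K))
        ((algebraMap K (v₀.adicCompletion K)).comp (algebraMap (𝓞 K) K))
        (fun _ => exists_valued_sub_lt_one) (A := c) fun r => by
          rw [RingHom.comp_apply, valued_algebraMap_adicCompletion]
          exact one_le hc r
    refine ChateletSurface.isEmpty_points_biquadratic _ _ _ _ Valued.v ?_ ?_ (hres hA) ?_ (hres hB)
    all_goals rw [valued_algebraMap_adicCompletion]
    exacts [hlog, v₀.valuation_le_one _, v₀.valuation_le_one _]
  · by_cases h2v : (2 : 𝓞 K) ∈ v.asIdeal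
    · exact ChateletSurface.nonempty_points_of_isSquare _ (hsq.1 v h2v)
    have not_mem_of_sub_one {c : 𝓞 K} (hc : c - 1 ∈ v.asIdeal) : c ∉ v.asIdeal := fun h =>
      v.isPrime.ne_top ((Ideal.eq_top_iff_one _).2 (by simpa using sub_mem h hc))
    -- If v divides a, A is a local square and the point lies over infinity. If v divides A but not
    -- a, -aB is a unit and the point lies over x = 0. If it divides neither, A is a unit and the
    -- point lies over infinity.
    by_cases hav : a ∈ v.asIdeal
    · have hA1 := (hAB v hv).1 hav
      obtain ⟨s, hs⟩ := isSquare_adicCompletion_of_sq_sub_mem (y := 1) h2v (not_mem_of_sub_one hA1)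
        (by simpa using neg_mem hA1)
      refine ChateletSurface.nonempty_points_of_eq_leadingCoeff _ (Y := s) (Z := 0) ?_
      rw [ChateletSurface.leadingCoeff_biquadratic_P, hs]
      ring
    by_cases hAv : A ∈ v.asIdeal
    · have hBv := (hAB v hv).2 hAv
      obtain ⟨Y, Z, h⟩ := exists_sq_sub_mul_sq_eq_adicCompletion h2v hav (c := -(a * B))
        fun h => (v.isPrime.mem_or_mem (neg_mem_iff.1 h)).elim hav hBv
      refine ChateletSurface.nonempty_points_of_eq_eval_zero _ (Y := Y) (Z := Z) ?_
      rw [ChateletSurface.coeff_zero_biquadratic_P]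
      refine h.trans ?_
      simp only [map_neg, map_mul]
    · obtain ⟨Y, Z, h⟩ := exists_sq_sub_mul_sq_eq_adicCompletion h2v hav hAv
      refine ChateletSurface.nonempty_points_of_eq_leadingCoeff _ (Y := Y) (Z := Z) ?_
      rwa [ChateletSurface.leadingCoeff_biquadratic_P]
  · refine ChateletSurface.nonempty_points_of_isSquare _ ?_
    rcases v.isReal_or_isComplex with hr | hc
    exacts [hsq.2 v hr, isSquare_completion_of_isComplex hc _]
  · intro L _ _ _ hL
    have : CharZero L := charZero_of_injective_algebraMap (algebraMap K L).injective
    have : FiniteDimensional ℚ L := Module.Finite.trans K L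
    have : NumberField L := ⟨⟩
    obtain ⟨w, hw, hwres⟩ := hL.exists_heightOneSpectrum
    have hres {c : 𝓞 K} (hc : ∀ r, r ^ 2 - c ∉ v₀.asIdeal) :=
      Valuation.one_le_map_sq_sub (w.valuation L) ((algebraMap K L).comp (algebraMap (𝓞 K) K))
        hwres (A := c) fun r => by
          rw [RingHom.comp_apply, hw]
          exact one_le hc r
    refine ChateletSurface.isEmpty_points_biquadratic _ _ _ _ (w.valuation L)
      ?_ ?_ (hres hA) ?_ (hres hB)
    all_goals rw [hw]
    exacts [hlog, v₀.valuation_le_one _, v₀.valuation_le_one _]
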